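/- Let $\eta>0$, let $N\ge 1$ be an integer, and let $q:\mathbb{R}\to\mathbb{R}$ be piecewise continuous with $\eta\,\mathbf 1_{[-1/2,1/2]}\le q\le \frac1\eta\,\mathbf 1_{[-N,N]}$. Let $\omega_0$ be a real random variable whose law has a bounded, compactly supported density. Let $G\in\mathbb{R}$ and let $W:(-N,N)\to\mathbb{R}$ be a deterministic, bounded (measurable) function. Let $\mathbb{T}=\mathbb{R}/\pi\mathbb{Z}$ carry the distance $d$ induced by the absolute value on $\mathbb{R}$. The direction of a vector $(u,v)\neq(0,0)$ of $\mathbb{R}^2$ is the class $\theta\in\mathbb{T}$ such that $(u,v)$ is a multiple of $(\sin\theta,\cos\theta)$. For $s\in\mathbb{R}$ let $\mathcal{T}_{s}:\mathbb{T}\to\mathbb{T}$ be the projective transfer map of $$-y''+(W+s\,q-G)\,y=0\quad\text{on }(-N,N),$$ that is, $\mathcal{T}_{s}(\Theta)$ is the direction of $(y(N),y'(N))$, where $y$ is any non-zero solution such that $(y(-N),y'(-N))$ has direction $\Theta$. (A solution is a $C^1$ function on $[-N,N]$ whose derivative is absolutely continuous and which satisfies the equation almost everywhere.) Let $\Theta_1,\Theta_2\in\mathbb{T}$.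 Then there exist $\varepsilon_0>0$ and an integer $M\ge 1$ such that, for all $0<\varepsilon<\varepsilon_0$, $$\mathbb{P}\big(d(\mathcal{T}_{\omega_0}(\Theta_1),\Theta_2)\le\varepsilon\big)\le\Big(\frac{\varepsilon}{\varepsilon_0}\Big)^{1/M}.$$ -/

import Mathlib

open MeasureTheory ProbabilityTheory Set Filter Topology

namespace AlloyType

/-- Piecewise continuity on the line: on each bounded interval there are only finitely many
points of discontinuity, and one-sided limits exist at every point. -/
def PiecewiseContinuous (f : ℝ → ℝ) : Prop :=
  (∀ a b : ℝ, {x ∈ Icc a b | ¬ ContinuousAt f x}.Finite) ∧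
  (∀ x : ℝ, ∃ l : ℝ, Tendsto f (𝓝[<] x) (𝓝 l)) ∧
  (∀ x : ℝ, ∃ r : ℝ, Tendsto f (𝓝[>] x) (𝓝 r))

/-- `y` is a (Carathéodory) solution of `-y'' + V y = 0` on the interval from `a` to `b`, with
derivative `p`: `y` is differentiable with continuous derivative `p`, and `p` is the primitive
of the integrable function `V y` (so that `p` is absolutely continuous with `p' = V y` a.e.). -/
structure IsSolution (V : ℝ → ℝ) (a b : ℝ) (y p : ℝ → ℝ) : Prop where
  hasDeriv : ∀ x ∈ Icc a b, HasDerivWithinAt y (p x) (Icc a b) x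
  cont : ContinuousOn p (Icc a b)
  integrable : IntervalIntegrable (fun t => V t * y t) volume a b
  eq_integral : ∀ x ∈ Icc a b, p x = p a + ∫ t in a..x, V t * y t

open Classical in
/-- The pair `x ↦ (y x, y' x)`, where `y` is the solution of `-y'' + V y = 0` on `[a, b]` with
`y a = c` and `y' a = d`. (For integrable `V` this solution exists and is unique on `[a, b]`;
the value `0` is taken when there is none.) -/
noncomputable def solution (V : ℝ → ℝ) (a b c d : ℝ) : ℝ → ℝ × ℝ :=
  if h : ∃ Y : ℝ → ℝ × ℝ,
      IsSolution V a b (fun x => (Y x).1) (fun x => (Y x).2) ∧ Y a = (c, d)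
  then h.choose else 0

/-- The direction in `ℝ / πℤ` of a vector `(u, v) ≠ 0` of the plane: the class of any `θ` such
that `(u, v)` is a multiple of `(sin θ, cos θ)`. -/
noncomputable def direction (u v : ℝ) : AddCircle Real.pi :=
  ((Complex.arg ⟨v, u⟩ : ℝ) : AddCircle Real.pi)

theorem direction_neg (u v : ℝ) : direction (-u) (-v) = direction u v := by
  unfold direction
  have hneg : (⟨-v, -u⟩ : ℂ) = -⟨v, u⟩ := by
    apply Complex.ext <;> simp
  rw [hneg]
  by_cases hz : (⟨v, u⟩ : ℂ) = 0
  · rw [hz]; simp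
  · have h := Complex.arg_neg_coe_angle hz
    rw [← Real.Angle.coe_add, Real.Angle.angle_eq_iff_two_pi_dvd_sub] at h
    obtain ⟨k, hk⟩ := h
    rw [← sub_eq_zero, ← AddCircle.coe_sub, AddCircle.coe_eq_zero_iff]
    refine ⟨2 * k + 1, ?_⟩
    rw [zsmul_eq_mul]
    push_cast
    linarith

/-- `direction` inverts `θ ↦ ±(sin θ, cos θ)`. -/
theorem direction_sin_cos {R : ℝ} (hR : R ≠ 0) (θ : ℝ) :
    direction (R * Real.sin θ) (R * Real.cos θ) = (θ : AddCircle Real.pi) := by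
  have pos : ∀ r : ℝ, 0 < r →
      direction (r * Real.sin θ) (r * Real.cos θ) = (θ : AddCircle Real.pi) := by
    intro r hr
    unfold direction
    have hz : (⟨r * Real.cos θ, r * Real.sin θ⟩ : ℂ)
        = r * (Complex.cos θ + Complex.sin θ * Complex.I) := by
      apply Complex.ext <;>
        simp [Complex.cos_ofReal_re, Complex.sin_ofReal_re]
    have h := Complex.arg_mul_cos_add_sin_mul_I_coe_angle hr (θ : Real.Angle)
    rw [Real.Angle.cos_coe, Real.Angle.sin_coe, Complex.ofReal_cos, Complex.ofReal_sin,
      ← hz, Real.Angle.angle_eq_iff_two_pi_dvd_sub] at h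
    obtain ⟨k, hk⟩ := h
    rw [← sub_eq_zero, ← AddCircle.coe_sub, AddCircle.coe_eq_zero_iff]
    refine ⟨2 * k, ?_⟩
    rw [zsmul_eq_mul]
    push_cast
    linarith
  rcases lt_or_gt_of_ne hR with h | h
  · have := pos (-R) (by linarith)
    rw [← this, ← direction_neg]
    congr 1 <;> ring
  · exact pos R h

/-- With `h₁, h₂` the solutions of `-y'' + V y = 0` on `[a, b]` such that
`h₁(a) = h₂'(a) = 1`, `h₁'(a) = h₂(a) = 0`, and `y_θ = sin θ • h₁ + cos θ • h₂`, this is the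
direction of `(y_θ(b), y_θ'(b))`. -/
noncomputable def transferAngle (V : ℝ → ℝ) (a b θ : ℝ) : AddCircle Real.pi :=
  direction
    (Real.sin θ * (solution V a b 1 0 b).1 + Real.cos θ * (solution V a b 0 1 b).1)
    (Real.sin θ * (solution V a b 1 0 b).2 + Real.cos θ * (solution V a b 0 1 b).2)

theorem transferAngle_periodic (V : ℝ → ℝ) (a b : ℝ) :
    Function.Periodic (transferAngle V a b) Real.pi := by
  intro θ
  unfold transferAngle
  rw [Real.sin_add_pi, Real.cos_add_pi, ← direction_neg]
  congr 1 <;> ring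

/-- The projective transfer map `𝒯_{a,b,V} : ℝ/πℤ → ℝ/πℤ` of `-y'' + V y = 0` over `(a, b)`. -/
noncomputable def transfer (V : ℝ → ℝ) (a b : ℝ) :
    AddCircle Real.pi → AddCircle Real.pi :=
  (transferAngle_periodic V a b).lift

end AlloyType

/-!
The bound holds with exponent `1`, because for `q ≥ 0` the angle `s ↦ 𝒯_s(Θ₁)` is strictly monotone
in the coupling `s`, at a speed bounded below on compact sets. No derivative in `s` is needed: let
`y_s` be the solution with coupling `s` and initial direction `Θ₁`. The Lagrange identity
(`IsSolution.wronskian_sub_eq_integral`) for couplings `s` and `t` reads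
`y_s(N) y_t'(N) - y_s'(N) y_t(N) = (t - s) ∫ q y_s y_t`.
The left side is, up to the lengths of the two vectors, the sine of the angle between the directions
`𝒯_s(Θ₁)` and `𝒯_t(Θ₁)`, hence at most a constant times their distance
(`abs_det_le_mul_dist_direction`). On the right, `∫ q y_s y_t` is close to `∫ q y_{s₀}²` for `s`, `t`
near `s₀` (`exists_bound_and_lipschitz`, from Grönwall), and `∫ q y_{s₀}² > 0` since a nonzero
solution cannot vanish identically on `[-1/2, 1/2]` (`IsBoundedPotential.integral_mul_sq_pos`). So
`|s - t| ≤ K d(𝒯_s(Θ₁), 𝒯_t(Θ₁))` near each `s₀` (`transfer_locally_expanding`): near `s₀`, the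
couplings whose angle is within `ε` of `Θ₂` form a set of diameter `O(ε)`. Finitely many such
neighbourhoods cover the support of the density (`exists_volume_dist_le_le_mul`).

As the potential is only measurable and bounded, the existence of solutions
(`IsBoundedPotential.exists_isSolution`) comes from a fixed-point argument for the equivalent Volterra
equation, and the Lagrange identity from integration by parts for absolutely continuous functions.
-/

namespace AlloyType

/-! ### Bounded potentials and existence of solutions -/

/-- `V` is measurable and bounded by `C` on the open interval `(a, b)`, up to a null set as far as
measurability goes; nothing is asked of the values at the endpoints or outside. -/
structure IsBoundedPotential (V : ℝ → ℝ) (a b C : ℝ) : Prop where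
  aemeasurable : AEMeasurable V (volume.restrict (Ioo a b))
  bound : ∀ x ∈ Ioo a b, |V x| ≤ C

theorem IsBoundedPotential.intervalIntegrable_mul {V f : ℝ → ℝ} {a b C : ℝ}
    (hV : IsBoundedPotential V a b C) (hab : a ≤ b) (hf : ContinuousOn f (Icc a b)) :
    IntervalIntegrable (fun t => V t * f t) volume a b := by
  rw [intervalIntegrable_iff_integrableOn_Ioo_of_le hab]
  have h1 : IntegrableOn f (Ioo a b) := hf.integrableOn_Icc.mono_set Ioo_subset_Icc_self
  exact Integrable.bdd_mul (c := C) h1 hV.aemeasurable.aestronglyMeasurable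
    (ae_restrict_of_forall_mem measurableSet_Ioo hV.bound)

theorem abs_integral_le_pow_div_factorial {g : ℝ → ℝ} {a x K : ℝ} (n : ℕ) (hax : a ≤ x)
    (hg : ∀ t ∈ Icc a x, |g t| ≤ K * ((t - a) ^ n / n.factorial)) :
    |∫ t in a..x, g t| ≤ K * ((x - a) ^ (n + 1) / (n + 1).factorial) := by
  have h := intervalIntegral.norm_integral_le_of_norm_le (μ := volume) (f := g)
    (g := fun t => K * ((t - a) ^ n / n.factorial)) hax
    (Eventually.of_forall fun t ht => hg t (Ioc_subset_Icc_self ht))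
    (by apply Continuous.intervalIntegrable; fun_prop)
  refine h.trans (le_of_eq ?_)
  have hne : ((n + 1 : ℕ) : ℝ) ≠ 0 := by positivity
  have hne' : (n.factorial : ℝ) ≠ 0 := by positivity
  rw [intervalIntegral.integral_const_mul, intervalIntegral.integral_div,
    intervalIntegral.integral_comp_sub_right (fun t => t ^ n) a, integral_pow, Nat.factorial_succ]
  push_cast at hne ⊢
  field_simp
  simp

/-- The Volterra form of `y'' = V y`, `y a = c`, `y' a = d`, has a continuous solution on `[a, b]`: a
high iterate of the Picard map contracts `C([a, b])`, since its Lipschitz constant is at most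
`(C (b - a)²)ⁿ / n!`. -/
theorem exists_volterra_fixedPoint {V : ℝ → ℝ} {a b C : ℝ} (hab : a ≤ b) (hVm : AEMeasurable V)
    (hVb : ∀ x, |V x| ≤ C) (c d : ℝ) :
    ∃ y : ℝ → ℝ, Continuous y ∧
      ∀ x ∈ Icc a b, y x = c + ∫ t in a..x, (d + ∫ s in a..t, V s * y s) := by
  have hC : 0 ≤ C := (abs_nonneg _).trans (hVb 0)
  have hint : ∀ y : ℝ → ℝ, Continuous y → ∀ u v, IntervalIntegrable (fun s => V s * y s)
      volume u v := by
    intro y hy u v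
    rw [intervalIntegrable_iff]
    exact Integrable.bdd_mul (c := C) (hy.integrableOn_uIoc) hVm.aestronglyMeasurable.restrict
      (Eventually.of_forall hVb)
  have hpc : ∀ y : ℝ → ℝ, Continuous y → Continuous fun t => d + ∫ s in a..t, V s * y s :=
    fun y hy => continuous_const.add (intervalIntegral.continuous_primitive (hint y hy) a)
  have hext : ∀ y : C(Icc a b, ℝ), Continuous (IccExtend hab y) := fun y => y.continuous.Icc_extend'
  let T : C(Icc a b, ℝ) → C(Icc a b, ℝ) := fun y =>
    ⟨fun x => c + ∫ t in a..(x : ℝ), (d + ∫ s in a..t, V s * IccExtend hab y s),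
      (continuous_const.add (intervalIntegral.continuous_primitive
        (fun u v => (hpc _ (hext y)).intervalIntegrable u v) a)).comp continuous_subtype_val⟩
  -- two integrations turn a bound by `(x - a) ^ n / n!` into one by `(x - a) ^ (n + 2) / (n + 2)!`
  have hstep : ∀ (y z : C(Icc a b, ℝ)) (K : ℝ) (n : ℕ),
      (∀ x : Icc a b, |y x - z x| ≤ K * (((x : ℝ) - a) ^ n / n.factorial)) →
      ∀ x : Icc a b, |T y x - T z x| ≤
        C * K * (((x : ℝ) - a) ^ (n + 1 + 1) / (n + 1 + 1).factorial) := by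
    intro y z K n h x
    have e : T y x - T z x = ∫ t in a..(x : ℝ), ∫ s in a..t,
        V s * (IccExtend hab y s - IccExtend hab z s) := by
      change (c + ∫ t in a..(x : ℝ), (d + ∫ s in a..t, V s * IccExtend hab y s)) -
        (c + ∫ t in a..(x : ℝ), (d + ∫ s in a..t, V s * IccExtend hab z s)) = _
      rw [add_sub_add_left_eq_sub, ← intervalIntegral.integral_sub
        ((hpc _ (hext y)).intervalIntegrable _ _) ((hpc _ (hext z)).intervalIntegrable _ _)]
      refine intervalIntegral.integral_congr fun t _ => ?_
      simp only [add_sub_add_left_eq_sub]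
      rw [← intervalIntegral.integral_sub (hint _ (hext y) _ _) (hint _ (hext z) _ _)]
      simp only [mul_sub]
    rw [e]
    refine abs_integral_le_pow_div_factorial _ x.2.1 fun t ht => ?_
    refine abs_integral_le_pow_div_factorial _ ht.1 fun s hs => ?_
    have hs' : s ∈ Icc a b := ⟨hs.1, hs.2.trans (ht.2.trans x.2.2)⟩
    rw [abs_mul, IccExtend_of_mem hab _ hs', IccExtend_of_mem hab _ hs', mul_assoc]
    exact mul_le_mul (hVb s) (h ⟨s, hs'⟩) (abs_nonneg _) hC
  have hiter : ∀ (n : ℕ) (y z : C(Icc a b, ℝ)) (x : Icc a b), |T^[n] y x - T^[n] z x| ≤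
      C ^ n * dist y z * (((x : ℝ) - a) ^ (2 * n) / (2 * n).factorial) := by
    intro n y z
    induction n with
    | zero =>
      intro x
      have h := ContinuousMap.dist_apply_le_dist (f := y) (g := z) x
      rw [Real.dist_eq] at h
      simpa using h
    | succ n ih =>
      intro x
      rw [Function.iterate_succ_apply', Function.iterate_succ_apply', pow_succ', mul_assoc C]
      exact hstep _ _ _ _ ih x
  have hsmall : ∃ n : ℕ, (C * (b - a) ^ 2) ^ n / n.factorial < 1 :=
    ((FloorSemiring.tendsto_pow_div_factorial_atTop (C * (b - a) ^ 2)).eventually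
      (gt_mem_nhds one_pos)).exists
  obtain ⟨n, hn⟩ := hsmall
  have hn0 : 0 ≤ (C * (b - a) ^ 2) ^ n / n.factorial := by positivity
  have hcontr : ContractingWith ⟨_, hn0⟩ T^[n] := by
    refine ⟨hn, LipschitzWith.of_dist_le_mul fun y z => ?_⟩
    rw [ContinuousMap.dist_le (by positivity)]
    intro x
    refine (hiter n y z x).trans ?_
    have hx0 : 0 ≤ (x : ℝ) - a := sub_nonneg.2 x.2.1
    have hx1 : (x : ℝ) - a ≤ b - a := sub_le_sub_right x.2.2 a
    calc C ^ n * dist y z * (((x : ℝ) - a) ^ (2 * n) / (2 * n).factorial)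
        ≤ C ^ n * dist y z * ((b - a) ^ (2 * n) / n.factorial) := by
          have : (n.factorial : ℝ) ≤ (2 * n).factorial := by
            exact_mod_cast Nat.factorial_le (by omega)
          gcongr
      _ = (C * (b - a) ^ 2) ^ n / n.factorial * dist y z := by
          rw [mul_pow, ← pow_mul]; ring
  have : Nonempty C(Icc a b, ℝ) := ⟨0⟩
  have hfix := hcontr.isFixedPt_fixedPoint_iterate
  set y := hcontr.fixedPoint T^[n]
  refine ⟨IccExtend hab y, hext y, fun x hx => ?_⟩
  rw [IccExtend_of_mem hab _ hx]
  conv_lhs => rw [← hfix.eq]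
  rfl

theorem IsBoundedPotential.exists_isSolution {V : ℝ → ℝ} {a b C : ℝ}
    (hV : IsBoundedPotential V a b C) (hab : a < b) (c d : ℝ) :
    ∃ Y : ℝ → ℝ × ℝ, IsSolution V a b (fun x => (Y x).1) (fun x => (Y x).2) ∧ Y a = (c, d) := by
  have hC : 0 ≤ C := (abs_nonneg _).trans (hV.bound ((a + b) / 2) (by constructor <;> linarith))
  -- only the values of `V` on `(a, b)` matter, so `V` may be cut off outside
  have hbd : ∀ x, |(Ioo a b).indicator V x| ≤ C := by
    intro x
    by_cases hx : x ∈ Ioo a b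
    · rw [indicator_of_mem hx]; exact hV.bound x hx
    · rw [indicator_of_notMem hx]; simpa using hC
  obtain ⟨y, hy, hyeq⟩ := exists_volterra_fixedPoint hab.le
    ((aemeasurable_indicator_iff measurableSet_Ioo).2 hV.aemeasurable) hbd c d
  have hcut : ∀ x ∈ Icc a b,
      ∫ s in a..x, (Ioo a b).indicator V s * y s = ∫ s in a..x, V s * y s := by
    intro x hx
    refine intervalIntegral.integral_congr_ae ?_
    filter_upwards [Measure.ae_ne volume b] with s hs hsx
    rw [uIoc_of_le hx.1] at hsx
    rw [indicator_of_mem (show s ∈ Ioo a b from ⟨hsx.1, lt_of_le_of_ne (hsx.2.trans hx.2) hs⟩)]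
  have hint : ∀ u v, IntervalIntegrable (fun s => (Ioo a b).indicator V s * y s) volume u v := by
    intro u v
    rw [intervalIntegrable_iff]
    exact Integrable.bdd_mul (c := C) hy.integrableOn_uIoc
      ((aemeasurable_indicator_iff measurableSet_Ioo).2
        hV.aemeasurable).aestronglyMeasurable.restrict (Eventually.of_forall hbd)
  set p : ℝ → ℝ := fun t => d + ∫ s in a..t, (Ioo a b).indicator V s * y s with hp
  have hpc : Continuous p := continuous_const.add (intervalIntegral.continuous_primitive hint a)
  refine ⟨fun x => (y x, p x), ⟨fun x hx => ?_, hpc.continuousOn,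
    hV.intervalIntegrable_mul hab.le hy.continuousOn, fun x hx => ?_⟩, ?_⟩
  · refine HasDerivWithinAt.congr (f := fun x => c + ∫ t in a..x, p t) ?_ hyeq (hyeq x hx)
    exact (intervalIntegral.integral_hasDerivAt_right (hpc.intervalIntegrable _ _)
      hpc.stronglyMeasurable.stronglyMeasurableAtFilter hpc.continuousAt).const_add
        c |>.hasDerivWithinAt
  · simp only [hp, intervalIntegral.integral_same, add_zero, hcut x hx]
  · simp [hp, hyeq a (left_mem_Icc.2 hab.le)]

theorem IsBoundedPotential.isSolution_solution {V : ℝ → ℝ} {a b C : ℝ}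
    (hV : IsBoundedPotential V a b C) (hab : a < b) (c d : ℝ) :
    IsSolution V a b (fun x => (solution V a b c d x).1) (fun x => (solution V a b c d x).2) ∧
      solution V a b c d a = (c, d) := by
  unfold solution
  rw [dif_pos (hV.exists_isSolution hab c d)]
  exact (hV.exists_isSolution hab c d).choose_spec

/-! ### Lagrange identity and Grönwall estimate -/

theorem IsSolution.continuousOn {V y p : ℝ → ℝ} {a b : ℝ} (h : IsSolution V a b y p) :
    ContinuousOn y (Icc a b) := fun x hx => (h.hasDeriv x hx).continuousWithinAt

theorem eq_add_integral_of_hasDerivWithinAt {y p : ℝ → ℝ} {a b : ℝ}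
    (hy : ∀ x ∈ Icc a b, HasDerivWithinAt y (p x) (Icc a b) x) (hp : ContinuousOn p (Icc a b)) :
    ∀ x ∈ Icc a b, y x = y a + ∫ t in a..x, p t := by
  intro x hx
  have hsub : Icc a x ⊆ Icc a b := Icc_subset_Icc_right hx.2
  rw [intervalIntegral.integral_eq_sub_of_hasDerivAt_of_le hx.1
    (fun t ht => ((hy t (hsub ht)).continuousWithinAt).mono hsub)
    (fun t ht => (hy t (hsub (Ioo_subset_Icc_self ht))).hasDerivAt
      (Icc_mem_nhds ht.1 (ht.2.trans_le hx.2)))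
    ((hp.mono hsub).intervalIntegrable_of_Icc hx.1)]
  ring

/-- The product rule in integrated form for two primitives of integrable functions. -/
theorem mul_sub_mul_eq_integral_of_eq_primitive {φ ψ f g : ℝ → ℝ} {a b : ℝ} (hab : a ≤ b)
    (hf : IntervalIntegrable f volume a b) (hg : IntervalIntegrable g volume a b)
    (hφ : ∀ x ∈ Icc a b, φ x = φ a + ∫ t in a..x, f t)
    (hψ : ∀ x ∈ Icc a b, ψ x = ψ a + ∫ t in a..x, g t) :
    φ b * ψ b - φ a * ψ a = ∫ t in a..b, (f t * ψ t + φ t * g t) := by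
  have key : ∀ {f : ℝ → ℝ} (c : ℝ), IntervalIntegrable f volume a b →
      AbsolutelyContinuousOnInterval (fun x => c + ∫ t in a..x, f t) a b ∧
      ∀ᵐ x, x ∈ uIcc a b → HasDerivAt (fun x => c + ∫ t in a..x, f t) (f x) x := by
    intro f c hf
    refine ⟨AbsolutelyContinuousOnInterval.fun_add ?_
      (hf.absolutelyContinuousOnInterval_intervalIntegral left_mem_uIcc), ?_⟩
    · exact (LipschitzWith.const c).lipschitzOnWith.absolutelyContinuousOnInterval
    · filter_upwards [hf.ae_hasDerivAt_integral] with x hx hxm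
      exact (hx hxm a left_mem_uIcc).const_add c
  obtain ⟨acf, df⟩ := key (φ a) hf
  obtain ⟨acg, dg⟩ := key (ψ a) hg
  have h := acf.integral_deriv_mul_eq_sub acg
  rw [← hφ b (right_mem_Icc.2 hab), ← hψ b (right_mem_Icc.2 hab)] at h
  simp only [intervalIntegral.integral_same, add_zero] at h
  rw [← h]
  refine intervalIntegral.integral_congr_ae ?_
  filter_upwards [df, dg] with x hx1 hx2 hx
  have hx' : x ∈ uIcc a b := uIoc_subset_uIcc hx
  have hx'' : x ∈ Icc a b := by rwa [uIcc_of_le hab] at hx'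
  rw [(hx1 hx').deriv, (hx2 hx').deriv, ← hφ x hx'', ← hψ x hx'']

theorem IsSolution.mono {V y p : ℝ → ℝ} {a b x : ℝ} (h : IsSolution V a b y p)
    (hx : x ∈ Icc a b) : IsSolution V a x y p where
  hasDeriv t ht := (h.hasDeriv t ⟨ht.1, ht.2.trans hx.2⟩).mono (Icc_subset_Icc_right hx.2)
  cont := h.cont.mono (Icc_subset_Icc_right hx.2)
  integrable := h.integrable.mono_set (by
    rw [uIcc_of_le hx.1, uIcc_of_le (hx.1.trans hx.2)]; exact Icc_subset_Icc_right hx.2)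
  eq_integral t ht := h.eq_integral t ⟨ht.1, ht.2.trans hx.2⟩

theorem IsSolution.linear_comb {V y₁ p₁ y₂ p₂ : ℝ → ℝ} {a b : ℝ} (h₁ : IsSolution V a b y₁ p₁)
    (h₂ : IsSolution V a b y₂ p₂) (c d : ℝ) :
    IsSolution V a b (fun x => c * y₁ x + d * y₂ x) (fun x => c * p₁ x + d * p₂ x) where
  hasDeriv x hx := ((h₁.hasDeriv x hx).const_mul c).add ((h₂.hasDeriv x hx).const_mul d)
  cont := (continuousOn_const.mul h₁.cont).add (continuousOn_const.mul h₂.cont)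
  integrable := by
    refine ((h₁.integrable.const_mul c).add (h₂.integrable.const_mul d)).congr_ae
      (Eventually.of_forall fun t => ?_)
    ring
  eq_integral x hx := by
    have e : ∫ t in a..x, V t * (c * y₁ t + d * y₂ t) =
        c * (∫ t in a..x, V t * y₁ t) + d * ∫ t in a..x, V t * y₂ t := by
      rw [← intervalIntegral.integral_const_mul, ← intervalIntegral.integral_const_mul,
        ← intervalIntegral.integral_add ((h₁.mono hx).integrable.const_mul c)
          ((h₂.mono hx).integrable.const_mul d)]
      congr 1
      ext t
      ring
    rw [e, h₁.eq_integral x hx, h₂.eq_integral x hx]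
    ring

/-- The Lagrange identity for solutions with two different potentials. For equal potentials it says
that the Wronskian is constant. -/
theorem IsSolution.wronskian_sub_eq_integral {V₁ V₂ y₁ p₁ y₂ p₂ : ℝ → ℝ} {a b : ℝ} (hab : a ≤ b)
    (h₁ : IsSolution V₁ a b y₁ p₁) (h₂ : IsSolution V₂ a b y₂ p₂) :
    (y₁ b * p₂ b - p₁ b * y₂ b) - (y₁ a * p₂ a - p₁ a * y₂ a) =
      ∫ t in a..b, (V₂ t - V₁ t) * (y₁ t * y₂ t) := by
  have i₁ := h₁.cont.intervalIntegrable_of_Icc (μ := volume) hab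
  have i₂ := h₂.cont.intervalIntegrable_of_Icc (μ := volume) hab
  have e₁ := mul_sub_mul_eq_integral_of_eq_primitive hab i₁ h₂.integrable
    (eq_add_integral_of_hasDerivWithinAt h₁.hasDeriv h₁.cont) h₂.eq_integral
  have e₂ := mul_sub_mul_eq_integral_of_eq_primitive hab h₁.integrable i₂ h₁.eq_integral
    (eq_add_integral_of_hasDerivWithinAt h₂.hasDeriv h₂.cont)
  have c₁ : ContinuousOn y₁ (uIcc a b) := by rw [uIcc_of_le hab]; exact h₁.continuousOn
  have c₂ : ContinuousOn y₂ (uIcc a b) := by rw [uIcc_of_le hab]; exact h₂.continuousOn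
  have d₁ : ContinuousOn p₁ (uIcc a b) := by rw [uIcc_of_le hab]; exact h₁.cont
  have d₂ : ContinuousOn p₂ (uIcc a b) := by rw [uIcc_of_le hab]; exact h₂.cont
  have : (y₁ b * p₂ b - p₁ b * y₂ b) - (y₁ a * p₂ a - p₁ a * y₂ a) =
      (y₁ b * p₂ b - y₁ a * p₂ a) - (p₁ b * y₂ b - p₁ a * y₂ a) := by ring
  rw [this, e₁, e₂, ← intervalIntegral.integral_sub
    ((i₁.mul_continuousOn d₂).add (h₂.integrable.continuousOn_mul c₁))
    ((h₁.integrable.mul_continuousOn c₂).add (i₂.continuousOn_mul d₁))]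
  congr 1
  ext t
  ring

/-- Grönwall's inequality for `y' = p`, `p' = f` with `|f| ≤ C |y| + κ`, where `p` is only the
primitive of `f`. -/
theorem abs_add_abs_le_of_eq_primitive {y p f : ℝ → ℝ} {a b C κ : ℝ} (hab : a ≤ b)
    (hC : 0 ≤ C) (hκ : 0 ≤ κ) (hy : ∀ x ∈ Icc a b, HasDerivWithinAt y (p x) (Icc a b) x)
    (hp : ContinuousOn p (Icc a b)) (hpf : ∀ x ∈ Icc a b, p x = p a + ∫ t in a..x, f t)
    (hf : ∀ x ∈ Ioo a b, |f x| ≤ C * |y x| + κ) :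
    ∀ x ∈ Icc a b, |y x| + |p x| ≤ (|y a| + |p a| + κ) * Real.exp ((C + 1) * (b - a)) := by
  have hyc : ContinuousOn y (Icc a b) := fun x hx => (hy x hx).continuousWithinAt
  have hmc : ContinuousOn (fun x => |y x| + |p x|) (Icc a b) := hyc.abs.add hp.abs
  -- extended continuously to the line, so that its primitive is differentiable everywhere
  set m : ℝ → ℝ := IccExtend hab (domRestrict (Icc a b) fun x => |y x| + |p x|)
  have hmcont : Continuous m := hmc.domRestrict.Icc_extend'
  have hmeq : ∀ x ∈ Icc a b, m x = |y x| + |p x| := fun x hx => IccExtend_of_mem hab _ hx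
  have hderiv : ∀ x, HasDerivAt (fun x => |y a| + |p a| + ∫ t in a..x, ((C + 1) * m t + κ))
      ((C + 1) * m x + κ) x := fun x => by
    have hc : Continuous fun t => (C + 1) * m t + κ := by fun_prop
    exact (intervalIntegral.integral_hasDerivAt_right (hc.intervalIntegrable _ _)
      hc.stronglyMeasurable.stronglyMeasurableAtFilter hc.continuousAt).const_add _
  -- `|y| + |p|` need not be differentiable; Grönwall's inequality is applied to the differentiable
  -- majorant `h`
  set h : ℝ → ℝ := fun x => |y a| + |p a| + ∫ t in a..x, ((C + 1) * m t + κ) with hh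
  have hle : ∀ x ∈ Icc a b, m x ≤ h x := by
    intro x hx
    have hcm : Continuous fun t => C * m t + κ := by fun_prop
    have e : h x = |y a| + |p a| + ((∫ t in a..x, m t) + ∫ t in a..x, (C * m t + κ)) := by
      rw [← intervalIntegral.integral_add (hmcont.intervalIntegrable _ _)
        (hcm.intervalIntegrable _ _)]
      simp only [hh]
      congr 2
      ext t
      ring
    have hmem : ∀ t, t ∈ Ioc a x → t ∈ Icc a b := fun t ht => ⟨ht.1.le, ht.2.trans hx.2⟩
    have b₁ : |∫ t in a..x, p t| ≤ ∫ t in a..x, m t := by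
      rw [← Real.norm_eq_abs]
      refine intervalIntegral.norm_integral_le_of_norm_le hx.1
        (Eventually.of_forall fun t ht => ?_) (hmcont.intervalIntegrable _ _)
      rw [hmeq t (hmem t ht), Real.norm_eq_abs]
      linarith [abs_nonneg (y t)]
    have b₂ : |∫ t in a..x, f t| ≤ ∫ t in a..x, (C * m t + κ) := by
      rw [← Real.norm_eq_abs]
      refine intervalIntegral.norm_integral_le_of_norm_le hx.1 ?_ (hcm.intervalIntegrable _ _)
      filter_upwards [Measure.ae_ne volume b] with t htb ht
      have ht' := hmem t ht
      rw [hmeq t ht', Real.norm_eq_abs]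
      have := hf t ⟨ht.1, lt_of_le_of_ne ht'.2 htb⟩
      nlinarith [mul_nonneg hC (abs_nonneg (p t))]
    rw [hmeq x hx, e, eq_add_integral_of_hasDerivWithinAt hy hp x hx, hpf x hx]
    linarith [abs_add_le (y a) (∫ t in a..x, p t), abs_add_le (p a) (∫ t in a..x, f t)]
  have hG := le_gronwallBound_of_liminf_deriv_right_le (f := h) (f' := fun x => (C + 1) * m x + κ)
    (δ := |y a| + |p a|) (K := C + 1) (ε := κ) (a := a) (b := b)
    (fun x _ => (hderiv x).continuousAt.continuousWithinAt)
    (fun x _ r hr => (hderiv x).hasDerivWithinAt.liminf_right_slope_le hr) (by simp [hh])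
    (fun x hx => by
      have := hle x (Ico_subset_Icc_self hx)
      gcongr)
  intro x hx
  rw [← hmeq x hx]
  refine (hle x hx).trans ((hG x hx).trans ?_)
  rw [gronwallBound_of_K_ne_0 (by positivity)]
  have e1 : Real.exp ((C + 1) * (x - a)) ≤ Real.exp ((C + 1) * (b - a)) := by
    have := hx.2
    gcongr
  have e2 : κ / (C + 1) ≤ κ := div_le_self hκ (by linarith)
  have e3 : 0 ≤ Real.exp ((C + 1) * (x - a)) - 1 := by
    have := hx.1
    rw [sub_nonneg, Real.one_le_exp_iff]
    exact mul_nonneg (by linarith) (by linarith)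
  calc (|y a| + |p a|) * Real.exp ((C + 1) * (x - a)) +
        κ / (C + 1) * (Real.exp ((C + 1) * (x - a)) - 1)
      ≤ (|y a| + |p a|) * Real.exp ((C + 1) * (b - a)) + κ * Real.exp ((C + 1) * (b - a)) := by
        gcongr
        linarith
    _ = _ := by ring

/-! ### Directions and determinants -/

theorem abs_sin_le_norm_coe (x : ℝ) : |Real.sin x| ≤ ‖(x : AddCircle Real.pi)‖ := by
  rw [AddCircle.norm_eq]
  calc |Real.sin x| = |Real.sin (x - round (Real.pi⁻¹ * x) * Real.pi)| := by
        rw [Real.sin_sub_int_mul_pi, abs_mul, abs_zpow, abs_neg, abs_one, one_zpow, one_mul]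
    _ ≤ _ := Real.abs_sin_le_abs

/-- The determinant of two plane vectors is the product of their lengths with the sine of the angle
between them, and this sine is at most the distance of the directions. -/
theorem abs_det_le_mul_dist_direction (u₁ v₁ u₂ v₂ : ℝ) :
    |u₁ * v₂ - v₁ * u₂| ≤
      (|u₁| + |v₁|) * (|u₂| + |v₂|) * dist (direction u₁ v₁) (direction u₂ v₂) := by
  have polar : ∀ u v : ℝ, u = ‖(⟨v, u⟩ : ℂ)‖ * Real.sin (Complex.arg ⟨v, u⟩) ∧
      v = ‖(⟨v, u⟩ : ℂ)‖ * Real.cos (Complex.arg ⟨v, u⟩) := fun u v =>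
    ⟨(Complex.norm_mul_sin_arg ⟨v, u⟩).symm, (Complex.norm_mul_cos_arg ⟨v, u⟩).symm⟩
  have hnorm : ∀ u v : ℝ, ‖(⟨v, u⟩ : ℂ)‖ ≤ |u| + |v| := fun u v => by
    rw [add_comm]; exact Complex.norm_le_abs_re_add_abs_im ⟨v, u⟩
  have hdet : u₁ * v₂ - v₁ * u₂ = ‖(⟨v₁, u₁⟩ : ℂ)‖ * ‖(⟨v₂, u₂⟩ : ℂ)‖ *
      Real.sin (Complex.arg ⟨v₁, u₁⟩ - Complex.arg ⟨v₂, u₂⟩) := by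
    rw [Real.sin_sub]
    linear_combination v₂ * (polar u₁ v₁).1 - u₂ * (polar u₁ v₁).2
      + ‖(⟨v₁, u₁⟩ : ℂ)‖ * Real.sin (Complex.arg ⟨v₁, u₁⟩) * (polar u₂ v₂).2
      - ‖(⟨v₁, u₁⟩ : ℂ)‖ * Real.cos (Complex.arg ⟨v₁, u₁⟩) * (polar u₂ v₂).1
  rw [hdet, abs_mul, abs_mul, abs_norm, abs_norm]
  refine mul_le_mul (mul_le_mul (hnorm _ _) (hnorm _ _) (norm_nonneg _) (by positivity)) ?_
    (abs_nonneg _) (by positivity)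
  unfold direction
  rw [dist_eq_norm, ← AddCircle.coe_sub]
  exact abs_sin_le_norm_coe _

/-! ### Solutions with prescribed initial angle -/

/-- The pair `(y x, y' x)`, where `y` is the solution of `-y'' + V y = 0` on `[a, b]` with
`(y a, y' a) = (sin θ, cos θ)`, written in the fundamental system used by `transferAngle`. -/
noncomputable def solutionWithAngle (V : ℝ → ℝ) (a b θ x : ℝ) : ℝ × ℝ :=
  (Real.sin θ * (solution V a b 1 0 x).1 + Real.cos θ * (solution V a b 0 1 x).1,
    Real.sin θ * (solution V a b 1 0 x).2 + Real.cos θ * (solution V a b 0 1 x).2)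

theorem transfer_coe (V : ℝ → ℝ) (a b θ : ℝ) : transfer V a b (θ : AddCircle Real.pi) =
    direction (solutionWithAngle V a b θ b).1 (solutionWithAngle V a b θ b).2 := rfl

section Family

variable {V : ℝ → ℝ} {a b C : ℝ}

theorem IsBoundedPotential.isSolution_solutionWithAngle (hV : IsBoundedPotential V a b C)
    (hab : a < b) (θ : ℝ) :
    IsSolution V a b (fun x => (solutionWithAngle V a b θ x).1)
      (fun x => (solutionWithAngle V a b θ x).2) :=
  (hV.isSolution_solution hab 1 0).1.linear_comb (hV.isSolution_solution hab 0 1).1 _ _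

theorem IsBoundedPotential.solutionWithAngle_left (hV : IsBoundedPotential V a b C)
    (hab : a < b) (θ : ℝ) : solutionWithAngle V a b θ a = (Real.sin θ, Real.cos θ) := by
  simp [solutionWithAngle, (hV.isSolution_solution hab 1 0).2, (hV.isSolution_solution hab 0 1).2]

/-- A nonzero solution and its derivative have no common zero: the Wronskian of the fundamental
system is constantly `1`. -/
theorem IsBoundedPotential.solutionWithAngle_ne_zero (hV : IsBoundedPotential V a b C)
    (hab : a < b) (θ : ℝ) {x : ℝ} (hx : x ∈ Icc a b) : solutionWithAngle V a b θ x ≠ 0 := by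
  intro h0
  obtain ⟨h₁, i₁⟩ := hV.isSolution_solution hab 1 0
  obtain ⟨h₂, i₂⟩ := hV.isSolution_solution hab 0 1
  have hw := (h₁.mono hx).wronskian_sub_eq_integral hx.1 (h₂.mono hx)
  simp only [i₁, i₂, sub_self, zero_mul, intervalIntegral.integral_zero, mul_one, mul_zero,
    sub_zero] at hw
  have e₁ := congrArg Prod.fst h0
  have e₂ := congrArg Prod.snd h0
  simp only [solutionWithAngle, Prod.fst_zero, Prod.snd_zero] at e₁ e₂
  have hs : Real.sin θ = 0 := by
    linear_combination (solution V a b 0 1 x).2 * e₁ - (solution V a b 0 1 x).1 * e₂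
      - Real.sin θ * hw
  have hc : Real.cos θ = 0 := by
    linear_combination (solution V a b 1 0 x).1 * e₂ - (solution V a b 1 0 x).2 * e₁
      - Real.cos θ * hw
  have := Real.sin_sq_add_cos_sq θ
  rw [hs, hc] at this
  norm_num at this

theorem IsBoundedPotential.exists_fst_ne_zero (hV : IsBoundedPotential V a b C)
    (hab : a < b) (θ : ℝ) {u v : ℝ} (huv : u < v) (hau : a ≤ u) (hvb : v ≤ b) :
    ∃ x ∈ Icc u v, (solutionWithAngle V a b θ x).1 ≠ 0 := by
  by_contra! h
  have hsub : Icc u v ⊆ Icc a b := Icc_subset_Icc hau hvb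
  have hu : u ∈ Icc u v := left_mem_Icc.2 huv.le
  have hd := ((hV.isSolution_solutionWithAngle hab θ).hasDeriv u (hsub hu)).mono hsub
  have hd0 : HasDerivWithinAt (fun x => (solutionWithAngle V a b θ x).1) 0 (Icc u v) u :=
    (hasDerivWithinAt_const u (Icc u v) (0 : ℝ)).congr h (h u hu)
  exact hV.solutionWithAngle_ne_zero hab θ (hsub hu) (Prod.ext (h u hu)
    ((uniqueDiffOn_Icc huv u hu).eq_deriv _ hd hd0))

theorem IsBoundedPotential.integral_mul_sq_pos {q : ℝ → ℝ} {Q η u v : ℝ}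
    (hV : IsBoundedPotential V a b C) (hq : IsBoundedPotential q a b Q) (hab : a < b)
    (hη : 0 < η) (huv : u < v) (hau : a ≤ u) (hvb : v ≤ b) (hq0 : ∀ x, 0 ≤ q x)
    (hqη : ∀ x ∈ Icc u v, η ≤ q x) (θ : ℝ) :
    0 < ∫ t in a..b, q t *
      ((solutionWithAngle V a b θ t).1 * (solutionWithAngle V a b θ t).1) := by
  have hc := (hV.isSolution_solutionWithAngle hab θ).continuousOn
  have hc2 := hc.mul hc
  have hsub : Icc u v ⊆ Icc a b := Icc_subset_Icc hau hvb
  have hint := hq.intervalIntegrable_mul hab.le hc2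
  obtain ⟨x, hx, hne⟩ := hV.exists_fst_ne_zero hab θ huv hau hvb
  have hpos : 0 < ∫ t in u..v, η *
      ((solutionWithAngle V a b θ t).1 * (solutionWithAngle V a b θ t).1) :=
    intervalIntegral.integral_pos huv (continuousOn_const.mul (hc2.mono hsub))
      (fun t _ => mul_nonneg hη.le (mul_self_nonneg _))
      ⟨x, hx, mul_pos hη (mul_self_pos.2 hne)⟩
  refine hpos.trans_le ((intervalIntegral.integral_mono_on huv.le
    ((continuousOn_const.mul (hc2.mono hsub)).intervalIntegrable_of_Icc huv.le)
    (hint.mono_set ?_) fun t ht => ?_).trans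
    (intervalIntegral.integral_mono_interval hau huv.le hvb
      (Eventually.of_forall fun t => mul_nonneg (hq0 t) (mul_self_nonneg _)) hint))
  · rwa [uIcc_of_le huv.le, uIcc_of_le hab.le]
  · exact mul_le_mul_of_nonneg_right (hqη t ht) (mul_self_nonneg _)

end Family

/-! ### Dependence on the coupling -/

section Coupling

variable {W q : ℝ → ℝ} {a b A Q : ℝ}

theorem isBoundedPotential_coupling (hW : IsBoundedPotential W a b A)
    (hq : IsBoundedPotential q a b Q) (G : ℝ) {s S : ℝ} (hs : |s| ≤ S) :
    IsBoundedPotential (fun t => W t + s * q t - G) a b (A + S * Q + |G|) where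
  aemeasurable := (hW.aemeasurable.add (hq.aemeasurable.const_mul s)).sub_const G
  bound x hx := by
    have h1 := hW.bound x hx
    have h2 : |s * q x| ≤ S * Q := by
      rw [abs_mul]
      exact mul_le_mul hs (hq.bound x hx) (abs_nonneg _) ((abs_nonneg _).trans hs)
    calc |W x + s * q x - G| ≤ |W x + s * q x| + |G| := abs_sub _ _
      _ ≤ |W x| + |s * q x| + |G| := by gcongr; exact abs_add_le _ _
      _ ≤ _ := by gcongr

/-- Near a coupling `s₀`, the solutions with fixed initial angle are bounded uniformly in the
coupling `s`, and their difference from the one for `s₀` is `O(|s - s₀|)`. -/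
theorem exists_bound_and_lipschitz (hW : IsBoundedPotential W a b A)
    (hq : IsBoundedPotential q a b Q) (hab : a < b) (G θ s₀ : ℝ) :
    ∃ B L : ℝ, 0 ≤ B ∧ 0 ≤ L ∧ ∀ s, |s - s₀| ≤ 1 → ∀ x ∈ Icc a b,
      |(solutionWithAngle (fun t => W t + s * q t - G) a b θ x).1| +
        |(solutionWithAngle (fun t => W t + s * q t - G) a b θ x).2| ≤ B ∧
      |(solutionWithAngle (fun t => W t + s * q t - G) a b θ x).1 -
        (solutionWithAngle (fun t => W t + s₀ * q t - G) a b θ x).1| ≤ L * |s - s₀| := by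
  have hmid : (a + b) / 2 ∈ Ioo a b := by constructor <;> linarith
  have hA : 0 ≤ A := (abs_nonneg _).trans (hW.bound _ hmid)
  have hQ : 0 ≤ Q := (abs_nonneg _).trans (hq.bound _ hmid)
  set C := A + (|s₀| + 1) * Q + |G|
  have hC : 0 ≤ C := by positivity
  set E := Real.exp ((C + 1) * (b - a))
  have hV : ∀ s, |s - s₀| ≤ 1 → IsBoundedPotential (fun t => W t + s * q t - G) a b C :=
    fun s hs => isBoundedPotential_coupling hW hq G (by
      have := abs_sub_abs_le_abs_sub s s₀
      linarith)
  have hbound : ∀ s, |s - s₀| ≤ 1 → ∀ x ∈ Icc a b,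
      |(solutionWithAngle (fun t => W t + s * q t - G) a b θ x).1| +
        |(solutionWithAngle (fun t => W t + s * q t - G) a b θ x).2| ≤ 2 * E := by
    intro s hs x hx
    have h := (hV s hs).isSolution_solutionWithAngle hab θ
    refine (abs_add_abs_le_of_eq_primitive hab.le hC le_rfl h.hasDeriv h.cont h.eq_integral
      (fun t ht => ?_) x hx).trans ?_
    · rw [abs_mul, add_zero]
      exact mul_le_mul_of_nonneg_right ((hV s hs).bound t ht) (abs_nonneg _)
    · rw [(hV s hs).solutionWithAngle_left hab θ]
      refine mul_le_mul_of_nonneg_right ?_ (Real.exp_pos _).le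
      linarith [Real.abs_sin_le_one θ, Real.abs_cos_le_one θ]
  refine ⟨2 * E, Q * (2 * E) * E, by positivity, by positivity, fun s hs x hx =>
    ⟨hbound s hs x hx, ?_⟩⟩
  have hs₀ : |s₀ - s₀| ≤ 1 := by simp
  have h := (hV s hs).isSolution_solutionWithAngle hab θ
  have h₀ := (hV s₀ hs₀).isSolution_solutionWithAngle hab θ
  -- the difference `z` of the two solutions satisfies `z'' = V_{s₀} z + (s - s₀) q y_s`
  have key := abs_add_abs_le_of_eq_primitive hab.le hC (κ := |s - s₀| * (Q * (2 * E)))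
    (by positivity) (fun x hx => (h.hasDeriv x hx).sub (h₀.hasDeriv x hx)) (h.cont.sub h₀.cont)
    (f := fun t => (W t + s * q t - G) *
        (solutionWithAngle (fun t => W t + s * q t - G) a b θ t).1 -
      (W t + s₀ * q t - G) * (solutionWithAngle (fun t => W t + s₀ * q t - G) a b θ t).1)
    (fun x hx => by
      rw [intervalIntegral.integral_sub (h.mono hx).integrable (h₀.mono hx).integrable]
      have e := h.eq_integral x hx
      have e₀ := h₀.eq_integral x hx
      linarith)
    (fun t ht => by
      have e : (W t + s * q t - G) *
            (solutionWithAngle (fun t => W t + s * q t - G) a b θ t).1 -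
          (W t + s₀ * q t - G) * (solutionWithAngle (fun t => W t + s₀ * q t - G) a b θ t).1 =
          (W t + s₀ * q t - G) *
            ((solutionWithAngle (fun t => W t + s * q t - G) a b θ t).1 -
              (solutionWithAngle (fun t => W t + s₀ * q t - G) a b θ t).1) +
          (s - s₀) * (q t * (solutionWithAngle (fun t => W t + s * q t - G) a b θ t).1) := by
        ring
      rw [e]
      refine (abs_add_le _ _).trans ?_
      rw [abs_mul, abs_mul (s - s₀), abs_mul (q t)]
      have b1 := (hV s₀ hs₀).bound t ht
      have b2 := hbound s hs t (Ioo_subset_Icc_self ht)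
      have b3 : |(solutionWithAngle (fun t => W t + s * q t - G) a b θ t).1| ≤ 2 * E := by
        linarith [abs_nonneg (solutionWithAngle (fun t => W t + s * q t - G) a b θ t).2]
      have b4 := hq.bound t ht
      simp only [Pi.sub_apply]
      gcongr)
    x hx
  simp only [Pi.sub_apply, (hV s hs).solutionWithAngle_left hab θ,
    (hV s₀ hs₀).solutionWithAngle_left hab θ, sub_self, abs_zero, zero_add] at key
  calc _ ≤ _ := (le_add_of_nonneg_right (abs_nonneg _)).trans key
    _ = _ := by ring

/-- Near each `s₀`, the angle `s ↦ 𝒯_s(Θ)` separates couplings at least linearly. -/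
theorem transfer_locally_expanding {η u v : ℝ} (hW : IsBoundedPotential W a b A)
    (hq : IsBoundedPotential q a b Q) (hab : a < b)
    (hη : 0 < η) (huv : u < v) (hau : a ≤ u) (hvb : v ≤ b) (hq0 : ∀ x, 0 ≤ q x)
    (hqη : ∀ x ∈ Icc u v, η ≤ q x) (G : ℝ) (Θ : AddCircle Real.pi) (s₀ : ℝ) :
    ∃ δ > 0, ∃ K : ℝ, ∀ s ∈ Metric.ball s₀ δ, ∀ t ∈ Metric.ball s₀ δ,
      |s - t| ≤ K * dist (transfer (fun x => W x + s * q x - G) a b Θ)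
        (transfer (fun x => W x + t * q x - G) a b Θ) := by
  obtain ⟨θ, rfl⟩ := QuotientAddGroup.mk_surjective Θ
  have hmid : (a + b) / 2 ∈ Ioo a b := by constructor <;> linarith
  have hQ : 0 ≤ Q := (abs_nonneg _).trans (hq.bound _ hmid)
  obtain ⟨B, L, hB, hL, hBL⟩ := exists_bound_and_lipschitz hW hq hab G θ s₀
  have hV : ∀ s, IsBoundedPotential (fun t => W t + s * q t - G) a b (A + |s| * Q + |G|) :=
    fun s => isBoundedPotential_coupling hW hq G le_rfl
  have hsol := fun s => (hV s).isSolution_solutionWithAngle hab θ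
  set y : ℝ → ℝ → ℝ := fun s x => (solutionWithAngle (fun t => W t + s * q t - G) a b θ x).1
  have hyc : ∀ s, ContinuousOn (y s) (Icc a b) := fun s => (hsol s).continuousOn
  have hF₀ : 0 < ∫ x in a..b, q x * (y s₀ x * y s₀ x) :=
    (hV s₀).integral_mul_sq_pos hq hab hη huv hau hvb hq0 hqη θ
  set F₀ := ∫ x in a..b, q x * (y s₀ x * y s₀ x)
  have hint : ∀ s t, IntervalIntegrable (fun x => q x * (y s x * y t x)) volume a b :=
    fun s t => hq.intervalIntegrable_mul hab.le ((hyc s).mul (hyc t))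
  have hba : 0 < b - a := sub_pos.2 hab
  -- for `s`, `t` within `δ ≤ 1` of `s₀`, the integral of `q y_s y_t` differs from `F₀` by at most
  -- `D * δ`; the choice of `δ` makes this at most `F₀ / 2`
  set D := Q * (2 * B * L) * (b - a) with hD
  have hD0 : 0 ≤ D := by positivity
  set δ := min 1 (F₀ / (2 * (D + 1)))
  have hδ0 : 0 < δ := lt_min one_pos (by positivity)
  have hδD : D * δ ≤ F₀ / 2 := by
    calc D * δ ≤ (D + 1) * (F₀ / (2 * (D + 1))) := by
          gcongr
          · linarith
          · exact min_le_right _ _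
      _ = F₀ / 2 := by field_simp
  refine ⟨δ, hδ0, B * B * (2 / F₀), fun s hs t ht => ?_⟩
  rw [Metric.mem_ball, Real.dist_eq] at hs ht
  have hs1 : |s - s₀| ≤ 1 := hs.le.trans (min_le_left _ _)
  have ht1 : |t - s₀| ≤ 1 := ht.le.trans (min_le_left _ _)
  have hs0 : |s₀ - s₀| ≤ 1 := by simp
  have hF : F₀ / 2 ≤ ∫ x in a..b, q x * (y s x * y t x) := by
    have hdiff : |(∫ x in a..b, q x * (y s x * y t x)) - F₀| ≤ D * δ := by
      rw [← intervalIntegral.integral_sub (hint s t) (hint s₀ s₀), ← Real.norm_eq_abs]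
      have hD' : D * δ = Q * (2 * B * L) * δ * |b - a| := by rw [abs_of_pos hba, hD]; ring
      rw [hD']
      refine intervalIntegral.norm_integral_le_of_norm_le_const_ae ?_
      filter_upwards [Measure.ae_ne volume b] with x hxb hx
      rw [uIoc_of_le hab.le] at hx
      have hxI : x ∈ Icc a b := Ioc_subset_Icc_self hx
      have e : q x * (y s x * y t x) - q x * (y s₀ x * y s₀ x) =
          q x * (y s x * (y t x - y s₀ x) + y s₀ x * (y s x - y s₀ x)) := by ring
      rw [e, Real.norm_eq_abs, abs_mul, mul_assoc Q]
      have c1 : |y s x| ≤ B := by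
        have := (hBL s hs1 x hxI).1
        exact (le_add_of_nonneg_right (abs_nonneg _)).trans this
      have c2 : |y s₀ x| ≤ B := by
        have := (hBL s₀ hs0 x hxI).1
        exact (le_add_of_nonneg_right (abs_nonneg _)).trans this
      have c3 : |y s x - y s₀ x| ≤ L * δ :=
        (hBL s hs1 x hxI).2.trans (mul_le_mul_of_nonneg_left hs.le hL)
      have c4 : |y t x - y s₀ x| ≤ L * δ :=
        (hBL t ht1 x hxI).2.trans (mul_le_mul_of_nonneg_left ht.le hL)
      refine mul_le_mul (hq.bound x ⟨hx.1, lt_of_le_of_ne hx.2 hxb⟩) ?_ (abs_nonneg _) hQ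
      calc |y s x * (y t x - y s₀ x) + y s₀ x * (y s x - y s₀ x)|
          ≤ |y s x| * |y t x - y s₀ x| + |y s₀ x| * |y s x - y s₀ x| := by
            rw [← abs_mul, ← abs_mul]; exact abs_add_le _ _
        _ ≤ B * (L * δ) + B * (L * δ) := by gcongr
        _ = 2 * B * L * δ := by ring
    have := (abs_le.1 hdiff).1
    linarith
  have hw := (hsol s).wronskian_sub_eq_integral hab.le (hsol t)
  rw [(hV s).solutionWithAngle_left hab θ, (hV t).solutionWithAngle_left hab θ] at hw
  have hI : ∫ x in a..b, ((W x + t * q x - G) - (W x + s * q x - G)) * (y s x * y t x) =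
      (t - s) * ∫ x in a..b, q x * (y s x * y t x) := by
    rw [← intervalIntegral.integral_const_mul]
    congr 1
    ext x
    ring
  rw [hI, mul_comm (Real.sin θ), sub_self, sub_zero] at hw
  have hdet := abs_det_le_mul_dist_direction
    (solutionWithAngle (fun x => W x + s * q x - G) a b θ b).1
    (solutionWithAngle (fun x => W x + s * q x - G) a b θ b).2
    (solutionWithAngle (fun x => W x + t * q x - G) a b θ b).1
    (solutionWithAngle (fun x => W x + t * q x - G) a b θ b).2
  rw [hw, abs_mul, ← transfer_coe, ← transfer_coe] at hdet
  have hbI : b ∈ Icc a b := right_mem_Icc.2 hab.le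
  have h1 : |s - t| * (F₀ / 2) ≤ B * B * dist
      (transfer (fun x => W x + s * q x - G) a b (θ : AddCircle Real.pi))
      (transfer (fun x => W x + t * q x - G) a b (θ : AddCircle Real.pi)) := by
    rw [abs_sub_comm]
    refine (mul_le_mul_of_nonneg_left (hF.trans (le_abs_self _)) (abs_nonneg _)).trans
      (hdet.trans ?_)
    have r1 := (hBL s hs1 b hbI).1
    have r2 := (hBL t ht1 b hbI).1
    gcongr
  rw [← le_div_iff₀ (by positivity)] at h1
  refine h1.trans (le_of_eq ?_)
  simp only [QuotientAddGroup.mk]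
  field_simp

end Coupling

/-! ### Measure estimates -/

/-- If `T` separates points locally at least linearly, then the part of `{s | dist (T s) x ≤ ε}` in a
compact set has measure `O(ε)`. -/
theorem exists_volume_dist_le_le_mul {X : Type*} [PseudoMetricSpace X] {T : ℝ → X}
    (hT : ∀ s₀, ∃ δ > 0, ∃ K : ℝ, ∀ s ∈ Metric.ball s₀ δ, ∀ t ∈ Metric.ball s₀ δ,
      |s - t| ≤ K * dist (T s) (T t)) {S : Set ℝ} (hS : IsCompact S) (x : X) :
    ∃ C : ℝ, 0 ≤ C ∧ ∀ ε : ℝ, 0 < ε →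
      volume (S ∩ {s | dist (T s) x ≤ ε}) ≤ ENNReal.ofReal (C * ε) := by
  refine hS.induction_on (p := fun S => ∃ C : ℝ, 0 ≤ C ∧ ∀ ε : ℝ, 0 < ε →
    volume (S ∩ {s | dist (T s) x ≤ ε}) ≤ ENNReal.ofReal (C * ε)) ?_ ?_ ?_ ?_
  · exact ⟨0, le_rfl, by simp⟩
  · rintro s t hst ⟨C, hC, h⟩
    exact ⟨C, hC, fun ε hε => (measure_mono (inter_subset_inter_left _ hst)).trans (h ε hε)⟩
  · rintro s t ⟨C₁, hC₁, h₁⟩ ⟨C₂, hC₂, h₂⟩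
    refine ⟨C₁ + C₂, by positivity, fun ε hε => ?_⟩
    rw [union_inter_distrib_right, add_mul, ENNReal.ofReal_add (by positivity) (by positivity)]
    exact (measure_union_le _ _).trans (add_le_add (h₁ ε hε) (h₂ ε hε))
  · intro s₀ _
    obtain ⟨δ, hδ, K, hK⟩ := hT s₀
    refine ⟨Metric.ball s₀ δ, mem_nhdsWithin_of_mem_nhds (Metric.ball_mem_nhds _ hδ),
      4 * max K 0, by positivity, fun ε hε => ?_⟩
    rcases (Metric.ball s₀ δ ∩ {s | dist (T s) x ≤ ε}).eq_empty_or_nonempty with he | ⟨t, ht⟩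
    · rw [he]; simp
    have hsub : Metric.ball s₀ δ ∩ {s | dist (T s) x ≤ ε} ⊆
        Metric.closedBall t (max K 0 * (2 * ε)) := by
      rintro s ⟨hs, hsx⟩
      rw [Metric.mem_closedBall, Real.dist_eq]
      have hd : dist (T s) (T t) ≤ 2 * ε := by
        have h2 : dist (T t) x ≤ ε := ht.2
        have h1 : dist (T s) x ≤ ε := hsx
        linarith [dist_triangle_right (T s) (T t) x]
      calc |s - t| ≤ K * dist (T s) (T t) := hK s hs t ht.1
        _ ≤ max K 0 * (2 * ε) := by
          gcongr
          exact le_max_left _ _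
    refine (measure_mono hsub).trans (le_of_eq ?_)
    rw [Real.volume_closedBall]
    congr 1
    ring

theorem withDensity_ofReal_apply_le {ρ : ℝ → ℝ} {K : ℝ} (hK : ∀ x, ρ x ≤ K) (S : Set ℝ) :
    volume.withDensity (fun x => ENNReal.ofReal (ρ x)) S ≤
      ENNReal.ofReal K * volume (tsupport ρ ∩ S) := by
  rw [withDensity_apply']
  calc ∫⁻ x in S, ENNReal.ofReal (ρ x)
      ≤ ∫⁻ x in S, (tsupport ρ).indicator (fun _ => ENNReal.ofReal K) x := by
        refine lintegral_mono fun x => ?_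
        by_cases hx : x ∈ tsupport ρ
        · rw [indicator_of_mem hx]; exact ENNReal.ofReal_le_ofReal (hK x)
        · rw [image_eq_zero_of_notMem_tsupport hx]; simp
    _ = ENNReal.ofReal K * volume (tsupport ρ ∩ S) := by
        rw [lintegral_indicator_const (isClosed_tsupport ρ).measurableSet,
          Measure.restrict_apply (isClosed_tsupport ρ).measurableSet]

theorem PiecewiseContinuous.aemeasurable {f : ℝ → ℝ} (hf : PiecewiseContinuous f) :
    AEMeasurable f := by
  have hcount : {x | ¬ ContinuousAt f x}.Countable := by
    have : {x | ¬ ContinuousAt f x} ⊆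
        ⋃ n : ℕ, {x ∈ Icc (-(n : ℝ)) n | ¬ ContinuousAt f x} := by
      intro x hx
      obtain ⟨n, hn⟩ := exists_nat_ge |x|
      exact mem_iUnion.2 ⟨n, abs_le.1 hn, hx⟩
    exact (countable_iUnion fun n : ℕ => (hf.1 (-n) n).countable).mono this
  have hc : ContinuousOn f {x | ¬ ContinuousAt f x}ᶜ :=
    fun x hx => (not_not.1 hx : ContinuousAt f x).continuousWithinAt
  have := hc.aemeasurable (μ := volume) hcount.measurableSet.compl
  rwa [Measure.restrict_eq_self_of_ae_mem] at this
  exact compl_mem_ae_iff.2 (hcount.measure_zero _)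

end AlloyType

theorem lemma3p11 {Ω : Type*} [MeasurableSpace Ω] (P : Measure Ω) [IsProbabilityMeasure P]
    -- the random variable, with a bounded, compactly supported density
    (ω₀ : Ω → ℝ) (ρ : ℝ → ℝ) (hρ_meas : Measurable ρ) (hρ_nonneg : ∀ x, 0 ≤ ρ x)
    (hρ_bdd : ∃ K : ℝ, ∀ x, ρ x ≤ K) (hρ_supp : HasCompactSupport ρ)
    (hω₀ : HasLaw ω₀ (volume.withDensity fun x => ENNReal.ofReal (ρ x)) P)
    -- the single-site potential
    (q : ℝ → ℝ) (hq_pc : AlloyType.PiecewiseContinuous q)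
    (η : ℝ) (hη : 0 < η) (N : ℕ) (hN : 1 ≤ N)
    (hq_upper : ∀ x, q x ≤ (1 / η) * (Icc (-(N : ℝ)) N).indicator 1 x)
    (hq_lower : ∀ x, η * (Icc (-(1 / 2 : ℝ)) (1 / 2)).indicator 1 x ≤ q x)
    -- the energy and the bounded deterministic background
    (G : ℝ) (W : ℝ → ℝ)
    (hW_meas : AEMeasurable W (volume.restrict (Ioo (-(N : ℝ)) N)))
    (hW_bdd : ∃ C : ℝ, ∀ x ∈ Ioo (-(N : ℝ)) N, |W x| ≤ C)
    (Θ₁ Θ₂ : AddCircle Real.pi) :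
    ∃ ε₀ : ℝ, 0 < ε₀ ∧ ∃ M : ℕ, 1 ≤ M ∧ ∀ ε : ℝ, 0 < ε → ε < ε₀ →
      P.real {x | dist
          (AlloyType.transfer (fun t => W t + ω₀ x * q t - G) (-(N : ℝ)) N Θ₁) Θ₂ ≤ ε}
        ≤ (ε / ε₀) ^ (1 / (M : ℝ)) := by
  obtain ⟨A, hA⟩ := hW_bdd
  obtain ⟨K, hK⟩ := hρ_bdd
  have hN' : (1 : ℝ) ≤ N := by exact_mod_cast hN
  have hab : -(N : ℝ) < N := by linarith
  have hq0 : ∀ x, 0 ≤ q x := fun x =>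
    (mul_nonneg hη.le (indicator_nonneg (fun _ _ => zero_le_one) x)).trans (hq_lower x)
  have hqη : ∀ x ∈ Icc (-(1 / 2 : ℝ)) (1 / 2), η ≤ q x := fun x hx => by
    have h := hq_lower x
    rwa [indicator_of_mem hx, Pi.one_apply, mul_one] at h
  have hq1 : ∀ x, q x ≤ 1 / η := fun x => (hq_upper x).trans
    (mul_le_of_le_one_right (by positivity)
      (indicator_le_self' (fun _ _ => zero_le_one) x))
  have hWV : AlloyType.IsBoundedPotential W (-(N : ℝ)) N A := ⟨hW_meas, hA⟩
  have hqV : AlloyType.IsBoundedPotential q (-(N : ℝ)) N (1 / η) :=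
    ⟨hq_pc.aemeasurable.restrict, fun x _ => by rw [abs_of_nonneg (hq0 x)]; exact hq1 x⟩
  have hlocal := AlloyType.transfer_locally_expanding hWV hqV hab hη
    (u := -(1 / 2)) (v := 1 / 2) (by norm_num) (by linarith) (by linarith) hq0 hqη G Θ₁
  obtain ⟨C, hC, hvol⟩ := AlloyType.exists_volume_dist_le_le_mul hlocal hρ_supp Θ₂
  have hK0 : 0 ≤ K := (hρ_nonneg 0).trans (hK 0)
  -- `S` below has probability at most `K * C * ε`, so the exponent `1 / M = 1` is reached, with the
  -- `+ 1` guarding against `K * C = 0`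
  refine ⟨1 / (K * C + 1), by positivity, 1, le_rfl, fun ε hε _ => ?_⟩
  set S : Set ℝ := {s | dist
    (AlloyType.transfer (fun t => W t + s * q t - G) (-(N : ℝ)) N Θ₁) Θ₂ ≤ ε}
  have hP : P (ω₀ ⁻¹' S) ≤ ENNReal.ofReal (K * (C * ε)) := by
    calc P (ω₀ ⁻¹' S) ≤ P.map ω₀ S := Measure.le_map_apply hω₀.aemeasurable S
      _ ≤ ENNReal.ofReal K * volume (tsupport ρ ∩ S) := by
        rw [hω₀.map_eq]; exact AlloyType.withDensity_ofReal_apply_le hK S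
      _ ≤ ENNReal.ofReal K * ENNReal.ofReal (C * ε) := by gcongr; exact hvol ε hε
      _ = _ := (ENNReal.ofReal_mul hK0).symm
  calc P.real (ω₀ ⁻¹' S) ≤ K * (C * ε) := ENNReal.toReal_le_of_le_ofReal (by positivity) hP
    _ ≤ ε / (1 / (K * C + 1)) := by
      rw [div_div_eq_mul_div, div_one]
      nlinarith
    _ = (ε / (1 / (K * C + 1))) ^ (1 / ((1 : ℕ) : ℝ)) := by simp
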